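/- Let $\epsilon,\delta\in(0,1)$, let $A\in\mathbb{R}^{n\times n}$ be symmetric positive definite with smallest eigenvalue $\lambda_{\min}(A)\ge 1$, and let $f(A)=\log(A)$ be its matrix logarithm. Let $k,p,N$ be natural numbers with $$k>\frac{64}{\delta^2},\qquad p\ge 1+\frac{64k}{k\delta^2-64},\qquad N\ge\frac{\bigl(1+\sqrt{1+4\epsilon\sqrt{\delta}}\bigr)^2}{2\epsilon^2\delta}.$$ Let $S\in\mathbb{R}^{n\times(k+p)}$ be a standard Gaussian random matrix (independent $\mathcal N(0,1)$ entries), and let $z^{(1)},\dots,z^{(N)}\in\mathbb{R}^n$ be independent Rademacher random vectors (all entries independent and equal to $\pm1$ with probability $1/2$ each), independent of $S$. Let $Q$ be a (random) matrix whose columns almost surely form an orthonormal basis of the range of $f(A)S$; thus $Q$ has $k+p$ columns if $f(A)S$ has full column rank, and $\operatorname{rank}(f(A)S)$ columns in general. Put $$\tilde\Delta=(I-QQ^T)f(A)(I-QQ^T),\qquad H^N(\tilde\Delta)=\frac1N\sum_{i=1}^N (z^{(i)})^T\tilde\Delta z^{(i)}.$$ Then, with respect to the joint randomness of $S$ and $z^{(1)},\dots,z^{(N)}$,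 $$\mathbb{P}\left\{\left|H^N(\tilde\Delta)-\operatorname{tr}(\tilde\Delta)\right|\le\frac{\epsilon}{4}\operatorname{tr}(f(A))\right\}\ge 1-\delta.$$ -/

import Mathlib

open MeasureTheory ProbabilityTheory
open scoped ENNReal Matrix

/-- The Rademacher distribution: the values `1` and `-1` with probability `1/2` each. -/
noncomputable def rademacherMeasure : Measure ℝ :=
  (2⁻¹ : ℝ≥0∞) • Measure.dirac (1 : ℝ) + (2⁻¹ : ℝ≥0∞) • Measure.dirac (-1 : ℝ)

/-- The random matrix `S` is standard Gaussian: its entries are independent and each of them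
has the standard normal law. -/
structure IsStdGaussianMatrix {Ω : Type*} [MeasurableSpace Ω] (μ : Measure Ω) {n q : ℕ}
    (S : Ω → Matrix (Fin n) (Fin q) ℝ) : Prop where
  hasLaw_entry : ∀ (i : Fin n) (j : Fin q), HasLaw (fun ω => S ω i j) (gaussianReal 0 1) μ
  indep_entries : iIndepFun (fun (e : Fin n × Fin q) (ω : Ω) => S ω e.1 e.2) μ

/-- The random vectors `z 0, …, z (N - 1)` are independent Rademacher vectors: all the entries
of all these vectors are independent and each of them has the Rademacher law. -/
structure IsRademacherFamily {Ω : Type*} [MeasurableSpace Ω] (μ : Measure Ω) {n N : ℕ}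
    (z : Fin N → Ω → Fin n → ℝ) : Prop where
  hasLaw_entry : ∀ (l : Fin N) (i : Fin n), HasLaw (fun ω => z l ω i) rademacherMeasure μ
  indep_entries : iIndepFun (fun (e : Fin N × Fin n) (ω : Ω) => z e.1 ω e.2) μ

/-- The columns of `Q` form an orthonormal basis of the range (column space) of `M`. -/
def IsOrthonormalBasisOfRange {n r q : ℕ} (Q : Matrix (Fin n) (Fin r) ℝ)
    (M : Matrix (Fin n) (Fin q) ℝ) : Prop :=
  Qᵀ * Q = 1 ∧ LinearMap.range Q.mulVecLin = LinearMap.range M.mulVecLin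

/-- The matrix logarithm of a symmetric positive definite matrix, `U (log Λ) Uᵀ` for an
eigendecomposition `A = U Λ Uᵀ`, as given by the functional calculus. -/
noncomputable def matrixLog {n : ℕ} (A : Matrix (Fin n) (Fin n) ℝ) : Matrix (Fin n) (Fin n) ℝ :=
  cfc Real.log A

/-- The deflated matrix `(I - Q Qᵀ) F (I - Q Qᵀ)`. -/
def deflated {n r : ℕ} (F : Matrix (Fin n) (Fin n) ℝ) (Q : Matrix (Fin n) (Fin r) ℝ) :
    Matrix (Fin n) (Fin n) ℝ :=
  (1 - Q * Qᵀ) * F * (1 - Q * Qᵀ)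

/-- The Hutchinson trace estimate `(1 / N) ∑ₗ zₗᵀ B zₗ` of `B` with the query vectors `zₗ`. -/
noncomputable def hutchinson {n N : ℕ} (B : Matrix (Fin n) (Fin n) ℝ) (z : Fin N → Fin n → ℝ) :
    ℝ :=
  (1 / (N : ℝ)) * ∑ l : Fin N, z l ⬝ᵥ (B *ᵥ z l)

/-! Write `F` for the logarithm, positive semidefinite because every eigenvalue of `A` is at least
1, and put `q = k + p`. The proof is a Chebyshev bound that rests on two second-moment estimates.

Hutchinson: for a random `B` independent of the Rademacher vectors, the mean squared error of the
estimator is at most `2 / N * E ‖B‖_F²` (`integral_hutchinson_sub_trace_sq_le`). Only off-diagonal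
entries contribute, and an index pair correlates only with itself and its reversal.

Sketch: projecting away the range of `F S` leaves a Frobenius norm no larger than that of `F - F S
X`, for every `X`, even a random one (`frobSq_deflated_le`). Take `X = (1/q) Sᵀ G`, with `G` a
spectral filter of `F`. Gaussian fourth moments give the mean squared error exactly, with no inverse
Wishart matrices involved (`integral_frobSq_sub_mul_gram`). A ridge-type choice of `G` makes it at
most `tr(F)² / 16` as soon as `q ≥ 128` (`exists_filter_sum_le`).

With threshold `ε/4 * tr F`, the failure probability is at most `2 / (N ε²) ≤ δ`.

`Q` need not depend measurably on the sample point. It is therefore replaced by a projection that is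
a measurable function of `S`, which also gives the independence from the query vectors. -/

/-! ### Fourth moments of independent standardized families -/

section Moments

variable {Ω ι : Type*} [MeasurableSpace Ω] {μ : Measure Ω} {X : ι → Ω → ℝ}

theorem integrable_mul_four (hL : ∀ i, MemLp (X i) 4 μ) (a b c d : ι) :
    Integrable (fun ω => X a ω * X b ω * (X c ω * X d ω)) μ := by
  have h442 : ENNReal.HolderTriple 4 4 2 := ⟨by
    rw [← two_mul, show (4 : ℝ≥0∞) = 2 * 2 by norm_num,
      ENNReal.mul_inv (by simp) (by simp), ← mul_assoc,
      ENNReal.mul_inv_cancel (by simp) (by simp), one_mul]⟩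
  have h1 : MemLp (fun ω => X a ω * X b ω) 2 μ := (hL b).mul (hL a)
  have h2 : MemLp (fun ω => X c ω * X d ω) 2 μ := (hL d).mul (hL c)
  exact h1.integrable_mul h2

/-- An index that occurs only once factors out by independence, and its mean is zero. Coincidences
among `b, c, d` are allowed. -/
theorem integral_mul_four_eq_zero (hind : iIndepFun X μ) (hL : ∀ i, MemLp (X i) 4 μ)
    (h1 : ∀ i, ∫ ω, X i ω ∂μ = 0) {a b c d : ι} (hab : a ≠ b) (hac : a ≠ c) (had : a ≠ d) :
    ∫ ω, X a ω * X b ω * (X c ω * X d ω) ∂μ = 0 := by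
  classical
  have hm : ∀ i, AEMeasurable (X i) μ := fun i => (hL i).1.aemeasurable
  have hi := hind.indepFun_finset₀ {a} {b, c, d} (by simp [hab, hac, had]) hm
  have hφ : Measurable fun v : (({a} : Finset ι) → ℝ) => v ⟨a, by simp⟩ := by fun_prop
  have hψ : Measurable fun v : (({b, c, d} : Finset ι) → ℝ) =>
      v ⟨b, by simp⟩ * (v ⟨c, by simp⟩ * v ⟨d, by simp⟩) := by fun_prop
  have hi' := hi.comp hφ hψ
  have := hi'.integral_mul_eq_mul_integral (hL a).1
    ((hL b).1.mul ((hL c).1.mul (hL d).1))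
  simp only [Function.comp_def, Pi.mul_def] at this
  simp_rw [mul_assoc]
  rw [this, h1, zero_mul]

theorem integral_sq_mul_sq_eq_one (hind : iIndepFun X μ) (hL : ∀ i, MemLp (X i) 4 μ)
    (h2 : ∀ i, ∫ ω, X i ω ^ 2 ∂μ = 1) {a b : ι} (hab : a ≠ b) :
    ∫ ω, X a ω ^ 2 * X b ω ^ 2 ∂μ = 1 := by
  have hi := (hind.indepFun hab).comp (φ := fun x => x ^ 2) (ψ := fun x => x ^ 2)
    (by fun_prop) (by fun_prop)
  have := hi.integral_mul_eq_mul_integral ((hL a).1.pow 2) ((hL b).1.pow 2)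
  simp only [Function.comp_def, Pi.mul_def] at this
  rw [this, h2, h2, one_mul]

/-- Fourth-order mixed moments of an independent family of standardized variables. -/
theorem integral_mul_four [DecidableEq ι] (hind : iIndepFun X μ) (hL : ∀ i, MemLp (X i) 4 μ)
    (h1 : ∀ i, ∫ ω, X i ω ∂μ = 0) (h2 : ∀ i, ∫ ω, X i ω ^ 2 ∂μ = 1) {κ : ℝ}
    (h4 : ∀ i, ∫ ω, X i ω ^ 4 ∂μ = κ) (a b c d : ι) :
    ∫ ω, X a ω * X b ω * (X c ω * X d ω) ∂μ
      = (if a = b then 1 else 0) * (if c = d then 1 else 0)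
        + (if a = c then 1 else 0) * (if b = d then 1 else 0)
        + (if a = d then 1 else 0) * (if b = c then 1 else 0)
        + (κ - 3) * (if a = b ∧ b = c ∧ c = d then 1 else 0) := by
  -- Either some index is isolated, and `z` applies after it is moved to the front, or the indices
  -- pair off, or all four agree. In the last case the three pairings already count 3, hence the
  -- correction `κ - 3`.
  have z := @integral_mul_four_eq_zero _ _ _ _ _ hind hL h1
  have o := @integral_sq_mul_sq_eq_one _ _ _ _ _ hind hL h2
  by_cases hab : a = b
  · subst hab
    by_cases hcd : c = d
    · subst hcd
      by_cases hac : a = c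
      · subst hac
        simp only [if_true, and_self]
        rw [← h4 a]
        ring_nf
      · have := o hac
        simp only [pow_two] at this
        simp [hac, this]
    · by_cases hac : a = c
      · subst hac
        have := z (Ne.symm hcd) (Ne.symm hcd) (Ne.symm hcd)
        simp only [hcd, if_false, and_false, mul_zero, add_zero, zero_mul]
        rw [← this]
        congr 1; ext ω; ring
      · have := z (Ne.symm hac) (Ne.symm hac) hcd
        simp only [hcd, hac, if_false, and_false, mul_zero, add_zero, zero_mul]
        rw [← this]
        congr 1; ext ω; ring
  · by_cases hac : a = c
    · subst hac
      by_cases hbd : b = d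
      · subst hbd
        have := o hab
        simp only [hab, if_false, if_true, false_and, mul_zero, zero_mul, mul_one, zero_add,
          add_zero]
        rw [← this]
        congr 1; ext ω; ring
      · have := z (Ne.symm hab) (Ne.symm hab) hbd
        simp only [hab, Ne.symm hab, hbd, if_false, if_true, false_and, mul_zero, zero_mul,
          zero_add]
        rw [← this]
        congr 1; ext ω; ring
    · by_cases had : a = d
      · subst had
        by_cases hbc : b = c
        · subst hbc
          have := o hab
          simp only [hab, if_false, if_true, false_and, mul_zero, zero_mul, mul_one, zero_add,
            add_zero]
          rw [← this]
          congr 1; ext ω; ring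
        · have := z (Ne.symm hab) hbc (Ne.symm hab)
          simp only [hab, hac, hbc, if_false, if_true, false_and, mul_zero, zero_mul,
            zero_add]
          rw [← this]
          congr 1; ext ω; ring
      · rw [z hab hac had]
        simp [hab, hac, had]

end Moments

/-! ### Moments of the Gaussian and Rademacher laws -/

section Laws

variable {Ω : Type*} [MeasurableSpace Ω] {μ : Measure Ω} {X : Ω → ℝ}

theorem memLp_four_of_hasLaw_gaussianReal (hX : HasLaw X (gaussianReal 0 1) μ) :
    MemLp X 4 μ := by
  have h := memLp_id_gaussianReal' (μ := 0) (v := 1) 4 (by simp)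
  rw [← hX.map_eq] at h
  exact h.comp_of_map hX.aemeasurable

theorem integral_of_hasLaw_gaussianReal (hX : HasLaw X (gaussianReal 0 1) μ) :
    ∫ ω, X ω ∂μ = 0 := by
  rw [hX.integral_eq, integral_id_gaussianReal]

theorem integral_sq_of_hasLaw_gaussianReal (hX : HasLaw X (gaussianReal 0 1) μ) :
    ∫ ω, X ω ^ 2 ∂μ = 1 := by
  have h := hX.integral_comp (f := fun x => x ^ 2) (by fun_prop)
  simp only [Function.comp_def] at h
  rw [h]
  have := variance_fun_id_gaussianReal (μ := 0) (v := 1)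
  rw [variance_of_integral_eq_zero (by fun_prop) integral_id_gaussianReal] at this
  simpa using this

theorem integral_pow_four_of_hasLaw_gaussianReal (hX : HasLaw X (gaussianReal 0 1) μ) :
    ∫ ω, X ω ^ 4 ∂μ = 3 := by
  have h := hX.integral_comp (f := fun x => x ^ 4) (by fun_prop)
  simp only [Function.comp_def] at h
  rw [h]
  have h4 := iteratedDeriv_mgf_zero (X := fun x : ℝ => x) (μ := gaussianReal 0 1)
    (by rw [integrableExpSet_fun_id_gaussianReal]; simp) 4
  simp only [Pi.pow_apply] at h4
  rw [← h4, mgf_fun_id_gaussianReal]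
  -- The moment is the fourth derivative at 0 of `exp (t² / 2)`. Differentiation sends the
  -- polynomial factor `P` to `P' + t P`, giving successively `1`, `t`, `1 + t²`, `3 t + t³`; the
  -- last derivative at 0 is 3.
  have key : ∀ (c0 c1 c2 c3 c4 : ℝ), deriv (fun t : ℝ =>
      (c0 + c1 * t + c2 * t ^ 2 + c3 * t ^ 3 + c4 * t ^ 4) * Real.exp (t ^ 2 / 2)) =
      fun t : ℝ => ((c1 + 2 * c2 * t + 3 * c3 * t ^ 2 + 4 * c4 * t ^ 3)
        + (c0 + c1 * t + c2 * t ^ 2 + c3 * t ^ 3 + c4 * t ^ 4) * t) * Real.exp (t ^ 2 / 2) := by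
    intro c0 c1 c2 c3 c4
    ext t
    have he : HasDerivAt (fun t : ℝ => Real.exp (t ^ 2 / 2)) (Real.exp (t ^ 2 / 2) * t) t := by
      have := ((hasDerivAt_pow 2 t).div_const 2).exp
      simpa using this
    have hp : HasDerivAt (fun t : ℝ => c0 + c1 * t + c2 * t ^ 2 + c3 * t ^ 3 + c4 * t ^ 4)
        (c1 + 2 * c2 * t + 3 * c3 * t ^ 2 + 4 * c4 * t ^ 3) t := by
      have := ((((hasDerivAt_const t c0).add ((hasDerivAt_id t).const_mul c1)).add
        ((hasDerivAt_pow 2 t).const_mul c2)).add ((hasDerivAt_pow 3 t).const_mul c3)).add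
        ((hasDerivAt_pow 4 t).const_mul c4)
      refine this.congr_deriv ?_
      norm_num
      ring
    refine (hp.mul he).deriv.trans ?_
    ring
  have e0 : (fun t : ℝ => Real.exp ((0 : ℝ) * t + ((1 : NNReal) : ℝ) * t ^ 2 / 2)) = fun t : ℝ =>
      (1 + 0 * t + 0 * t ^ 2 + 0 * t ^ 3 + 0 * t ^ 4) * Real.exp (t ^ 2 / 2) := by
    ext t; simp
  have e1 : deriv (fun t : ℝ => (1 + 0 * t + 0 * t ^ 2 + 0 * t ^ 3 + 0 * t ^ 4) *
      Real.exp (t ^ 2 / 2)) = fun t : ℝ =>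
      (0 + 1 * t + 0 * t ^ 2 + 0 * t ^ 3 + 0 * t ^ 4) * Real.exp (t ^ 2 / 2) := by
    rw [key]; ext t; ring
  have e2 : deriv (fun t : ℝ => (0 + 1 * t + 0 * t ^ 2 + 0 * t ^ 3 + 0 * t ^ 4) *
      Real.exp (t ^ 2 / 2)) = fun t : ℝ =>
      (1 + 0 * t + 1 * t ^ 2 + 0 * t ^ 3 + 0 * t ^ 4) * Real.exp (t ^ 2 / 2) := by
    rw [key]; ext t; ring
  have e3 : deriv (fun t : ℝ => (1 + 0 * t + 1 * t ^ 2 + 0 * t ^ 3 + 0 * t ^ 4) *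
      Real.exp (t ^ 2 / 2)) = fun t : ℝ =>
      (0 + 3 * t + 0 * t ^ 2 + 1 * t ^ 3 + 0 * t ^ 4) * Real.exp (t ^ 2 / 2) := by
    rw [key]; ext t; ring
  rw [e0]
  simp only [iteratedDeriv_succ, iteratedDeriv_zero]
  rw [e1, e2, e3, key]
  norm_num

theorem integral_rademacherMeasure (f : ℝ → ℝ) :
    ∫ x, f x ∂rademacherMeasure = (f 1 + f (-1)) / 2 := by
  have h : ∀ a : ℝ, Integrable f ((2⁻¹ : ℝ≥0∞) • Measure.dirac a) := fun a =>
    (integrable_dirac (by simp [enorm_eq_nnnorm])).smul_measure (by simp)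
  unfold rademacherMeasure
  rw [integral_add_measure (h 1) (h (-1)), integral_smul_measure, integral_smul_measure,
    integral_dirac, integral_dirac]
  simp
  ring

theorem sq_eq_one_of_hasLaw_rademacherMeasure (hX : HasLaw X rademacherMeasure μ) :
    ∀ᵐ ω ∂μ, X ω ^ 2 = 1 := by
  refine (hX.ae_iff (p := fun x => x ^ 2 = 1)
    (measurableSet_setOfPred.1 (measurableSet_eq_fun (by fun_prop) (by fun_prop)))).2 ?_
  unfold rademacherMeasure
  rw [ae_add_measure_iff, Measure.ae_ennreal_smul_measure_iff (by simp),
    Measure.ae_ennreal_smul_measure_iff (by simp), ae_dirac_eq, ae_dirac_eq]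
  simp

theorem memLp_four_of_hasLaw_rademacherMeasure [IsFiniteMeasure μ]
    (hX : HasLaw X rademacherMeasure μ) : MemLp X 4 μ := by
  refine MemLp.of_bound hX.aemeasurable.aestronglyMeasurable 1 ?_
  filter_upwards [sq_eq_one_of_hasLaw_rademacherMeasure hX] with ω h
  rw [Real.norm_eq_abs, ← sq_le_one_iff_abs_le_one, h]

theorem integral_pow_of_hasLaw_rademacherMeasure (hX : HasLaw X rademacherMeasure μ) (m : ℕ) :
    ∫ ω, X ω ^ m ∂μ = (1 + (-1) ^ m) / 2 := by
  have h := hX.integral_comp (f := fun x => x ^ m) (by fun_prop)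
  simp only [Function.comp_def] at h
  rw [h, integral_rademacherMeasure]
  simp

end Laws

/-! ### Orthogonal projections, Frobenius norms and measurability -/

section Projection

variable {n m q r : ℕ}

/-- The squared Frobenius norm. -/
def frobSq (M : Matrix (Fin n) (Fin m) ℝ) : ℝ := (Mᵀ * M).trace

theorem frobSq_eq_sum (M : Matrix (Fin n) (Fin m) ℝ) : frobSq M = ∑ i, ∑ j, M i j ^ 2 := by
  simp only [frobSq, Matrix.trace, Matrix.diag, Matrix.mul_apply, Matrix.transpose_apply]
  rw [Finset.sum_comm]
  simp [pow_two]

theorem frobSq_nonneg (M : Matrix (Fin n) (Fin m) ℝ) : 0 ≤ frobSq M := by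
  rw [frobSq_eq_sum]; positivity

theorem frobSq_transpose (M : Matrix (Fin n) (Fin m) ℝ) : frobSq Mᵀ = frobSq M := by
  rw [frobSq, frobSq, Matrix.trace_mul_comm, Matrix.transpose_transpose]

theorem compl_transpose (Q : Matrix (Fin n) (Fin r) ℝ) : (1 - Q * Qᵀ)ᵀ = 1 - Q * Qᵀ := by
  simp

variable {Q : Matrix (Fin n) (Fin r) ℝ}

theorem compl_mul_self (hQ : Qᵀ * Q = 1) : (1 - Q * Qᵀ) * Q = 0 := by
  rw [Matrix.sub_mul, Matrix.one_mul, Matrix.mul_assoc, hQ, Matrix.mul_one, sub_self]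

theorem compl_mul_compl (hQ : Qᵀ * Q = 1) : (1 - Q * Qᵀ) * (1 - Q * Qᵀ) = 1 - Q * Qᵀ := by
  rw [Matrix.mul_sub, Matrix.mul_one, ← Matrix.mul_assoc, compl_mul_self hQ, Matrix.zero_mul,
    sub_zero]

/-- Pythagoras: the difference of the two sides is `frobSq (Qᵀ * M)`. -/
theorem frobSq_compl_mul_le (hQ : Qᵀ * Q = 1) (M : Matrix (Fin n) (Fin m) ℝ) :
    frobSq ((1 - Q * Qᵀ) * M) ≤ frobSq M := by
  have h : frobSq M - frobSq ((1 - Q * Qᵀ) * M) = frobSq (Qᵀ * M) := by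
    simp only [frobSq]
    rw [Matrix.transpose_mul (1 - Q * Qᵀ), compl_transpose, Matrix.mul_assoc,
      ← Matrix.mul_assoc (1 - Q * Qᵀ), compl_mul_compl hQ, ← Matrix.trace_sub, Matrix.sub_mul,
      Matrix.one_mul, Matrix.mul_sub, sub_sub_cancel]
    simp [Matrix.mul_assoc]
  linarith [frobSq_nonneg (Qᵀ * M)]

theorem compl_mul_of_isOrthonormalBasisOfRange {M : Matrix (Fin n) (Fin q) ℝ}
    (hQ : IsOrthonormalBasisOfRange Q M) : (1 - Q * Qᵀ) * M = 0 := by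
  refine Matrix.ext_of_mulVec_single fun j => ?_
  have hmem : M *ᵥ Pi.single j 1 ∈ LinearMap.range Q.mulVecLin := by
    rw [hQ.2]; exact ⟨_, rfl⟩
  obtain ⟨y, hy⟩ := hmem
  rw [Matrix.mulVecLin_apply] at hy
  rw [← Matrix.mulVec_mulVec, ← hy, Matrix.mulVec_mulVec, compl_mul_self hQ.1,
    Matrix.zero_mulVec, Matrix.zero_mulVec]

/-- The projection kills `M`, so `F` may be replaced by `F - M * X` under the left factor; both
projection factors then only decrease the norm. The freedom in `X` lets an explicit sketch bound the
deflated matrix. -/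
theorem frobSq_deflated_le {M : Matrix (Fin n) (Fin q) ℝ} {F : Matrix (Fin n) (Fin n) ℝ}
    (hQ : IsOrthonormalBasisOfRange Q M) (X : Matrix (Fin q) (Fin n) ℝ) :
    frobSq (deflated F Q) ≤ frobSq (F - M * X) := by
  have h1 : (1 - Q * Qᵀ) * F = (1 - Q * Qᵀ) * (F - M * X) := by
    rw [Matrix.mul_sub, ← Matrix.mul_assoc, compl_mul_of_isOrthonormalBasisOfRange hQ,
      Matrix.zero_mul, sub_zero]
  rw [deflated, ← frobSq_transpose, Matrix.transpose_mul, compl_transpose]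
  refine (frobSq_compl_mul_le hQ.1 _).trans ?_
  rw [frobSq_transpose, h1]
  exact frobSq_compl_mul_le hQ.1 _

/-- The squared distance from `v` to the column space of `M`, as an infimum over rational
coefficient vectors. -/
noncomputable def residualSq (M : Matrix (Fin n) (Fin q) ℝ) (v : Fin n → ℝ) : ℝ :=
  ⨅ x : Fin q → ℚ, (v - M *ᵥ fun i => (x i : ℝ)) ⬝ᵥ (v - M *ᵥ fun i => (x i : ℝ))

theorem dotProduct_compl_mulVec (hQ : Qᵀ * Q = 1) (v : Fin n → ℝ) :
    v ⬝ᵥ ((1 - Q * Qᵀ) *ᵥ v) = ((1 - Q * Qᵀ) *ᵥ v) ⬝ᵥ ((1 - Q * Qᵀ) *ᵥ v) := by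
  conv_lhs => rw [← compl_mul_compl hQ, ← Matrix.mulVec_mulVec, Matrix.dotProduct_mulVec,
    ← Matrix.mulVec_transpose, compl_transpose]

theorem dotProduct_compl_mulVec_le (Q : Matrix (Fin n) (Fin r) ℝ) (v : Fin n → ℝ) :
    v ⬝ᵥ ((1 - Q * Qᵀ) *ᵥ v) ≤ v ⬝ᵥ v := by
  have h : v ⬝ᵥ v - v ⬝ᵥ ((1 - Q * Qᵀ) *ᵥ v) = (Qᵀ *ᵥ v) ⬝ᵥ (Qᵀ *ᵥ v) := by
    rw [Matrix.sub_mulVec, Matrix.one_mulVec, dotProduct_sub, sub_sub_cancel,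
      ← Matrix.mulVec_mulVec, Matrix.dotProduct_mulVec, ← Matrix.mulVec_transpose]
  have h0 : 0 ≤ (Qᵀ *ᵥ v) ⬝ᵥ (Qᵀ *ᵥ v) := Finset.sum_nonneg fun i _ => mul_self_nonneg _
  linarith

theorem residualSq_eq {M : Matrix (Fin n) (Fin q) ℝ} (hQ : IsOrthonormalBasisOfRange Q M)
    (v : Fin n → ℝ) : residualSq M v = v ⬝ᵥ ((1 - Q * Qᵀ) *ᵥ v) := by
  have hlow : ∀ x : Fin q → ℝ,
      v ⬝ᵥ ((1 - Q * Qᵀ) *ᵥ v) ≤ (v - M *ᵥ x) ⬝ᵥ (v - M *ᵥ x) := by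
    intro x
    have h := dotProduct_compl_mulVec_le Q (v - M *ᵥ x)
    rwa [dotProduct_compl_mulVec hQ.1, Matrix.mulVec_sub, Matrix.mulVec_mulVec,
      compl_mul_of_isOrthonormalBasisOfRange hQ, Matrix.zero_mulVec, sub_zero,
      ← dotProduct_compl_mulVec hQ.1] at h
  obtain ⟨y, hy⟩ : Q *ᵥ (Qᵀ *ᵥ v) ∈ LinearMap.range M.mulVecLin := by
    rw [← hQ.2]; exact ⟨_, rfl⟩
  have hat : (v - M *ᵥ y) ⬝ᵥ (v - M *ᵥ y) = v ⬝ᵥ ((1 - Q * Qᵀ) *ᵥ v) := by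
    rw [Matrix.mulVecLin_apply] at hy
    rw [dotProduct_compl_mulVec hQ.1, hy, Matrix.sub_mulVec, Matrix.one_mulVec,
      Matrix.mulVec_mulVec]
  refine le_antisymm ?_ (le_ciInf fun x => hlow _)
  refine le_of_forall_pos_lt_add fun η hη => ?_
  -- The least-squares minimum is attained at a real vector `y`; by continuity and density, rational
  -- vectors come within `η` of it.
  have hopen : IsOpen {x : Fin q → ℝ |
      (v - M *ᵥ x) ⬝ᵥ (v - M *ᵥ x) < v ⬝ᵥ ((1 - Q * Qᵀ) *ᵥ v) + η} :=
    isOpen_lt (by fun_prop) continuous_const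
  have hd : DenseRange (Pi.map fun (_ : Fin q) (x : ℚ) => (x : ℝ)) :=
    DenseRange.piMap fun _ => Rat.denseRange_cast
  obtain ⟨x, hx⟩ := hd.exists_mem_open hopen ⟨y, by
    rw [Set.mem_ofPred_eq, hat]; linarith⟩
  refine lt_of_le_of_lt (ciInf_le ⟨v ⬝ᵥ ((1 - Q * Qᵀ) *ᵥ v), ?_⟩ x) hx
  rintro _ ⟨x, rfl⟩
  exact hlow _

/-- The orthogonal projection onto the orthogonal complement of the column space of `M`,
obtained from `residualSq` by polarization. -/
noncomputable def complProj (M : Matrix (Fin n) (Fin q) ℝ) : Matrix (Fin n) (Fin n) ℝ :=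
  Matrix.of fun i j => (residualSq M (Pi.single i 1 + Pi.single j 1)
    - residualSq M (Pi.single i 1) - residualSq M (Pi.single j 1)) / 2

theorem complProj_eq {M : Matrix (Fin n) (Fin q) ℝ} (hQ : IsOrthonormalBasisOfRange Q M) :
    complProj M = 1 - Q * Qᵀ := by
  ext i j
  have hs : (1 - Q * Qᵀ : Matrix (Fin n) (Fin n) ℝ) j i
      = (1 - Q * Qᵀ : Matrix (Fin n) (Fin n) ℝ) i j := by
    conv_lhs => rw [← compl_transpose, Matrix.transpose_apply]
  simp only [complProj, Matrix.of_apply, residualSq_eq hQ]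
  simp only [Matrix.mulVec_add, add_dotProduct, dotProduct_add, Matrix.mulVec_single_one,
    single_dotProduct, Matrix.col_apply, one_mul, hs]
  ring

/-- An infimum of countably many measurable functions is measurable; this is why `residualSq` ranges
over rational vectors. -/
theorem measurable_complProj {E : Type*} [MeasurableSpace E] {M : E → Matrix (Fin n) (Fin q) ℝ}
    (hM : ∀ i j, Measurable fun e => M e i j) (i j : Fin n) :
    Measurable fun e => complProj (M e) i j := by
  have h : ∀ v : Fin n → ℝ, Measurable fun e => residualSq (M e) v := by
    intro v
    refine Measurable.iInf fun x => ?_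
    simp only [dotProduct, Matrix.mulVec, Pi.sub_apply]
    fun_prop
  simp only [complProj, Matrix.of_apply]
  have := h (Pi.single i 1 + Pi.single j 1)
  have := h (Pi.single i 1)
  have := h (Pi.single j 1)
  fun_prop

end Projection

/-! ### Variance of the Hutchinson estimator -/

section Hutchinson

variable {Ω : Type*} [MeasurableSpace Ω] {μ : Measure Ω}
  {n N : ℕ} {z : Fin N → Ω → Fin n → ℝ} {B : Ω → Matrix (Fin n) (Fin n) ℝ}

theorem integral_mul_four_rademacher [IsProbabilityMeasure μ] (hz : IsRademacherFamily μ z) (a b c d : Fin N × Fin n)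
    (hab : a ≠ b) :
    ∫ ω, z a.1 ω a.2 * z b.1 ω b.2 * (z c.1 ω c.2 * z d.1 ω d.2) ∂μ
      = (if a = c then 1 else 0) * (if b = d then 1 else 0)
        + (if a = d then 1 else 0) * (if b = c then 1 else 0) := by
  have h := integral_mul_four (κ := 1) hz.indep_entries
    (fun e => memLp_four_of_hasLaw_rademacherMeasure (hz.hasLaw_entry e.1 e.2))
    (fun e => by
      simpa using integral_pow_of_hasLaw_rademacherMeasure (hz.hasLaw_entry e.1 e.2) 1)
    (fun e => by
      rw [integral_pow_of_hasLaw_rademacherMeasure (hz.hasLaw_entry e.1 e.2)]; norm_num)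
    (fun e => by
      rw [integral_pow_of_hasLaw_rademacherMeasure (hz.hasLaw_entry e.1 e.2)]; norm_num) a b c d
  rw [h]
  simp [hab]

/-- The off-diagonal part of a matrix. -/
def offDiag (M : Matrix (Fin n) (Fin n) ℝ) : Matrix (Fin n) (Fin n) ℝ :=
  Matrix.of fun i j => if i = j then 0 else M i j

/-- Squared signs equal 1, so the diagonal terms of each quadratic form add up to the trace exactly
and cancel. -/
theorem hutchinson_sub_trace (hN : N ≠ 0) (M : Matrix (Fin n) (Fin n) ℝ) (y : Fin N → Fin n → ℝ)
    (hy : ∀ l i, y l i ^ 2 = 1) :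
    hutchinson M y - M.trace
      = (1 / (N : ℝ)) * ∑ e : Fin N × Fin n × Fin n,
        offDiag M e.2.1 e.2.2 * (y e.1 e.2.1 * y e.1 e.2.2) := by
  have hN' : (N : ℝ) ≠ 0 := by exact_mod_cast hN
  have h : ∀ l, y l ⬝ᵥ (M *ᵥ y l)
      = M.trace + ∑ i, ∑ j, offDiag M i j * (y l i * y l j) := by
    intro l
    simp only [dotProduct, Matrix.mulVec, Matrix.trace, Matrix.diag, Finset.mul_sum]
    rw [← Finset.sum_add_distrib]
    refine Finset.sum_congr rfl fun i _ => ?_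
    have h1 : M i i = ∑ j, if i = j then M i j else 0 := by simp
    rw [h1, ← Finset.sum_add_distrib]
    refine Finset.sum_congr rfl fun j _ => ?_
    by_cases hij : i = j
    · subst hij
      have := hy l i
      simp only [offDiag, Matrix.of_apply, if_true]
      linear_combination M i i * this
    · simp only [offDiag, Matrix.of_apply, hij, if_false]
      ring
  simp only [hutchinson, h, Fintype.sum_prod_type]
  rw [Finset.sum_add_distrib]
  simp only [Finset.sum_const, Finset.card_univ, Fintype.card_fin, nsmul_eq_mul]
  field_simp
  ring

theorem memLp_offDiag (hB : ∀ i j, MemLp (fun ω => B ω i j) 2 μ) (i j : Fin n) :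
    MemLp (fun ω => offDiag (B ω) i j) 2 μ := by
  by_cases hij : i = j
  · simp [offDiag, hij]
  · simpa [offDiag, hij] using hB i j

theorem integral_offDiag_mul_le (hB : ∀ i j, MemLp (fun ω => B ω i j) 2 μ) (i j i' j' : Fin n) :
    ∫ ω, offDiag (B ω) i j * offDiag (B ω) i' j' ∂μ
      ≤ (∫ ω, B ω i j ^ 2 ∂μ + ∫ ω, B ω i' j' ^ 2 ∂μ) / 2 := by
  rw [← integral_add (hB i j).integrable_sq (hB i' j').integrable_sq, ← integral_div]
  refine integral_mono ((memLp_offDiag hB i j).integrable_mul (memLp_offDiag hB i' j'))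
    (((hB i j).integrable_sq.add (hB i' j').integrable_sq).div_const 2) fun ω => ?_
  simp only [offDiag, Matrix.of_apply]
  split_ifs <;> nlinarith [sq_nonneg (B ω i j - B ω i' j'), sq_nonneg (B ω i j),
    sq_nonneg (B ω i' j')]

variable [IsProbabilityMeasure μ] (hz : IsRademacherFamily μ z)
  (hind : IndepFun (fun ω (e : Fin n × Fin n) => B ω e.1 e.2)
    (fun ω (e : Fin N × Fin n) => z e.1 ω e.2) μ)
  (hB : ∀ i j, MemLp (fun ω => B ω i j) 2 μ)

include hz hind hB

/-- Independence splits off the moment of the matrix entries. In the sign moment, off-diagonal pairs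
leave only the two pairings across `e` and `f`: equal triples, or triples with the last two indices
exchanged. -/
theorem integral_quad_mul_quad (e f : Fin N × Fin n × Fin n) :
    Integrable (fun ω => (offDiag (B ω) e.2.1 e.2.2 * (z e.1 ω e.2.1 * z e.1 ω e.2.2))
      * (offDiag (B ω) f.2.1 f.2.2 * (z f.1 ω f.2.1 * z f.1 ω f.2.2))) μ
    ∧ ∫ ω, (offDiag (B ω) e.2.1 e.2.2 * (z e.1 ω e.2.1 * z e.1 ω e.2.2))
      * (offDiag (B ω) f.2.1 f.2.2 * (z f.1 ω f.2.1 * z f.1 ω f.2.2)) ∂μ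
    = (∫ ω, offDiag (B ω) e.2.1 e.2.2 * offDiag (B ω) f.2.1 f.2.2 ∂μ) *
      ((if e = f then 1 else 0) + (if e = (f.1, f.2.2, f.2.1) then 1 else 0)) := by
  obtain ⟨l, i, j⟩ := e
  obtain ⟨l', i', j'⟩ := f
  have hzm : ∀ a : Fin N × Fin n, MemLp (fun ω => z a.1 ω a.2) 4 μ := fun a =>
    memLp_four_of_hasLaw_rademacherMeasure (hz.hasLaw_entry a.1 a.2)
  have hφ : Measurable fun v : Fin n × Fin n → ℝ =>
      (if i = j then 0 else v (i, j)) * (if i' = j' then 0 else v (i', j')) := by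
    split_ifs <;> fun_prop
  have hψ : Measurable fun v : Fin N × Fin n → ℝ =>
      v (l, i) * v (l, j) * (v (l', i') * v (l', j')) := by fun_prop
  have hi := hind.comp hφ hψ
  have hI1 : Integrable (fun ω => offDiag (B ω) i j * offDiag (B ω) i' j') μ :=
    (memLp_offDiag hB i j).integrable_mul (memLp_offDiag hB i' j')
  have hI2 := integrable_mul_four hzm (l, i) (l, j) (l', i') (l', j')
  have hI := hi.integrable_mul hI1 hI2
  have hE := hi.integral_mul_eq_mul_integral hI1.1 hI2.1
  have hcongr : (fun ω => (offDiag (B ω) i j * (z l ω i * z l ω j))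
      * (offDiag (B ω) i' j' * (z l' ω i' * z l' ω j')))
      = (fun ω => offDiag (B ω) i j * offDiag (B ω) i' j')
        * fun ω => z l ω i * z l ω j * (z l' ω i' * z l' ω j') := by
    ext ω; simp only [Pi.mul_apply]; ring
  refine ⟨hcongr ▸ hI, ?_⟩
  simp only
  rw [hcongr]
  refine hE.trans ?_
  change (∫ ω, offDiag (B ω) i j * offDiag (B ω) i' j' ∂μ) * _ = _
  by_cases hij : i = j
  · simp [offDiag, hij]
  congr 1
  refine (integral_mul_four_rademacher hz (l, i) (l, j) (l', i') (l', j')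
    (by simp [hij])).trans ?_
  simp only [Prod.mk.injEq, ite_and]
  split_ifs <;> simp_all

/-- Second moment of the error of the Hutchinson estimator of a random matrix that is independent
of the query vectors. -/
theorem integral_hutchinson_sub_trace_sq_le (hN : N ≠ 0) :
    Integrable (fun ω => (hutchinson (B ω) (fun l => z l ω) - (B ω).trace) ^ 2) μ ∧
    ∫ ω, (hutchinson (B ω) (fun l => z l ω) - (B ω).trace) ^ 2 ∂μ
      ≤ 2 / N * ∫ ω, frobSq (B ω) ∂μ := by
  have hN' : (0 : ℝ) < N := by exact_mod_cast Nat.pos_of_ne_zero hN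
  have hae : (fun ω => (hutchinson (B ω) (fun l => z l ω) - (B ω).trace) ^ 2) =ᵐ[μ]
      fun ω => (1 / (N : ℝ)) ^ 2 * ∑ e : Fin N × Fin n × Fin n, ∑ f : Fin N × Fin n × Fin n,
        (offDiag (B ω) e.2.1 e.2.2 * (z e.1 ω e.2.1 * z e.1 ω e.2.2))
      * (offDiag (B ω) f.2.1 f.2.2 * (z f.1 ω f.2.1 * z f.1 ω f.2.2)) := by
    have h1 : ∀ᵐ ω ∂μ, ∀ l i, z l ω i ^ 2 = 1 := by
      simp only [ae_all_iff]
      exact fun l i => sq_eq_one_of_hasLaw_rademacherMeasure (hz.hasLaw_entry l i)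
    filter_upwards [h1] with ω hω
    rw [hutchinson_sub_trace hN _ _ hω, mul_pow, pow_two (Finset.sum _ _), Finset.sum_mul_sum]
  have hq := integral_quad_mul_quad hz hind hB
  have hint : Integrable (fun ω => (1 / (N : ℝ)) ^ 2 *
      ∑ e : Fin N × Fin n × Fin n, ∑ f : Fin N × Fin n × Fin n,
        (offDiag (B ω) e.2.1 e.2.2 * (z e.1 ω e.2.1 * z e.1 ω e.2.2))
      * (offDiag (B ω) f.2.1 f.2.2 * (z f.1 ω f.2.1 * z f.1 ω f.2.2))) μ :=
    (integrable_finsetSum _ fun e _ => integrable_finsetSum _ fun f _ => (hq e f).1).const_mul _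
  refine ⟨hint.congr hae.symm, ?_⟩
  rw [integral_congr_ae hae, integral_const_mul,
    integral_finsetSum _ fun e _ => integrable_finsetSum _ fun f _ => (hq e f).1]
  have hstep : ∀ e : Fin N × Fin n × Fin n,
      ∫ ω, ∑ f : Fin N × Fin n × Fin n,
        (offDiag (B ω) e.2.1 e.2.2 * (z e.1 ω e.2.1 * z e.1 ω e.2.2))
      * (offDiag (B ω) f.2.1 f.2.2 * (z f.1 ω f.2.1 * z f.1 ω f.2.2)) ∂μ
      = ∫ ω, offDiag (B ω) e.2.1 e.2.2 * offDiag (B ω) e.2.1 e.2.2 ∂μ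
        + ∫ ω, offDiag (B ω) e.2.1 e.2.2 * offDiag (B ω) e.2.2 e.2.1 ∂μ := by
    intro e
    rw [integral_finsetSum _ fun f _ => (hq e f).1]
    simp only [fun f => (hq e f).2, mul_add, Finset.sum_add_distrib]
    congr 1
    · simp
    · have : ∀ f : Fin N × Fin n × Fin n,
          (e = (f.1, f.2.2, f.2.1)) ↔ ((e.1, e.2.2, e.2.1) = f) := by
        rintro ⟨f1, f2, f3⟩
        obtain ⟨e1, e2, e3⟩ := e
        simp only [Prod.mk.injEq]
        tauto
      simp [this]
  -- `B` is not assumed symmetric, so the product of mirrored entries is bounded by the mean of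
  -- their squares. The weights 3/2 and 1/2 sum to the factor 2.
  have hle : ∀ e : Fin N × Fin n × Fin n,
      ∫ ω, offDiag (B ω) e.2.1 e.2.2 * offDiag (B ω) e.2.1 e.2.2 ∂μ
        + ∫ ω, offDiag (B ω) e.2.1 e.2.2 * offDiag (B ω) e.2.2 e.2.1 ∂μ
      ≤ 3 / 2 * ∫ ω, B ω e.2.1 e.2.2 ^ 2 ∂μ + 1 / 2 * ∫ ω, B ω e.2.2 e.2.1 ^ 2 ∂μ := by
    intro e
    have h1 := integral_offDiag_mul_le hB e.2.1 e.2.2 e.2.1 e.2.2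
    have h2 := integral_offDiag_mul_le hB e.2.1 e.2.2 e.2.2 e.2.1
    linarith
  have hfrob : ∫ ω, frobSq (B ω) ∂μ = ∑ i, ∑ j, ∫ ω, B ω i j ^ 2 ∂μ := by
    simp only [frobSq_eq_sum]
    rw [integral_finsetSum _ fun i _ => integrable_finsetSum _ fun j _ => (hB i j).integrable_sq]
    exact Finset.sum_congr rfl fun i _ => integral_finsetSum _ fun j _ => (hB i j).integrable_sq
  have hsum : ∑ e : Fin N × Fin n × Fin n,
      (3 / 2 * ∫ ω, B ω e.2.1 e.2.2 ^ 2 ∂μ + 1 / 2 * ∫ ω, B ω e.2.2 e.2.1 ^ 2 ∂μ)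
      = 2 * N * ∫ ω, frobSq (B ω) ∂μ := by
    have hswap : ∑ i, ∑ j, ∫ ω, B ω j i ^ 2 ∂μ = ∑ i, ∑ j, ∫ ω, B ω i j ^ 2 ∂μ :=
      Finset.sum_comm
    simp only [Fintype.sum_prod_type, Finset.sum_add_distrib, ← Finset.mul_sum, hswap, ← hfrob,
      Finset.sum_const, Finset.card_univ, Fintype.card_fin, nsmul_eq_mul]
    ring
  calc (1 / (N : ℝ)) ^ 2 * ∑ e : Fin N × Fin n × Fin n, _
      ≤ (1 / (N : ℝ)) ^ 2 * (2 * N * ∫ ω, frobSq (B ω) ∂μ) := by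
        rw [← hsum]
        gcongr with e
        rw [hstep e]
        exact hle e
    _ = 2 / N * ∫ ω, frobSq (B ω) ∂μ := by field_simp

end Hutchinson

/-! ### Second moments of the Gram matrix of a Gaussian sketch -/

section Gaussian

variable {Ω : Type*} [MeasurableSpace Ω] {μ : Measure Ω}
  {n q : ℕ} {S : Ω → Matrix (Fin n) (Fin q) ℝ}

theorem memLp_four_entry (hS : IsStdGaussianMatrix μ S) (a : Fin n × Fin q) :
    MemLp (fun ω => S ω a.1 a.2) 4 μ :=
  memLp_four_of_hasLaw_gaussianReal (hS.hasLaw_entry a.1 a.2)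

theorem integral_mul_four_gaussian (hS : IsStdGaussianMatrix μ S) (a b c d : Fin n × Fin q) :
    ∫ ω, S ω a.1 a.2 * S ω b.1 b.2 * (S ω c.1 c.2 * S ω d.1 d.2) ∂μ
      = (if a = b then 1 else 0) * (if c = d then 1 else 0)
        + (if a = c then 1 else 0) * (if b = d then 1 else 0)
        + (if a = d then 1 else 0) * (if b = c then 1 else 0) := by
  rw [integral_mul_four (κ := 3) hS.indep_entries (memLp_four_entry hS)
    (fun e => integral_of_hasLaw_gaussianReal (hS.hasLaw_entry e.1 e.2))
    (fun e => integral_sq_of_hasLaw_gaussianReal (hS.hasLaw_entry e.1 e.2))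
    (fun e => integral_pow_four_of_hasLaw_gaussianReal (hS.hasLaw_entry e.1 e.2)) a b c d]
  ring

theorem integrable_mul_two_gaussian [IsProbabilityMeasure μ] (hS : IsStdGaussianMatrix μ S) (a b : Fin n × Fin q) :
    Integrable (fun ω => S ω a.1 a.2 * S ω b.1 b.2) μ :=
  ((memLp_four_entry hS a).mono_exponent (p := 2) (by norm_num)).integrable_mul
    ((memLp_four_entry hS b).mono_exponent (p := 2) (by norm_num))

theorem integral_mul_two_gaussian (hS : IsStdGaussianMatrix μ S) (a b : Fin n × Fin q) :
    ∫ ω, S ω a.1 a.2 * S ω b.1 b.2 ∂μ = if a = b then 1 else 0 := by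
  by_cases hab : a = b
  · subst hab
    simp only [if_true, ← pow_two]
    exact integral_sq_of_hasLaw_gaussianReal (hS.hasLaw_entry a.1 a.2)
  · have := (hS.indep_entries.indepFun hab).integral_mul_eq_mul_integral
      (memLp_four_entry hS a).1 (memLp_four_entry hS b).1
    rw [integral_of_hasLaw_gaussianReal (hS.hasLaw_entry a.1 a.2), zero_mul] at this
    simpa [hab] using this

theorem gram_apply (M : Matrix (Fin n) (Fin q) ℝ) (i j : Fin n) :
    (M * Mᵀ) i j = ∑ a, M i a * M j a := rfl

theorem integrable_gram [IsProbabilityMeasure μ] (hS : IsStdGaussianMatrix μ S) (i j : Fin n) :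
    Integrable (fun ω => (S ω * (S ω)ᵀ) i j) μ := by
  simp only [gram_apply]
  exact integrable_finsetSum _ fun a _ => integrable_mul_two_gaussian hS (i, a) (j, a)

theorem integral_gram [IsProbabilityMeasure μ] (hS : IsStdGaussianMatrix μ S) (i j : Fin n) :
    ∫ ω, (S ω * (S ω)ᵀ) i j ∂μ = q * if i = j then 1 else 0 := by
  simp only [gram_apply]
  rw [integral_finsetSum _ fun a _ => integrable_mul_two_gaussian hS (i, a) (j, a)]
  simp only [fun a => integral_mul_two_gaussian hS (i, a) (j, a)]
  simp

theorem gram_mul_gram (M : Matrix (Fin n) (Fin q) ℝ) (i j k l : Fin n) :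
    (M * Mᵀ) i j * (M * Mᵀ) k l = ∑ a, ∑ b, M i a * M j a * (M k b * M l b) := by
  rw [gram_apply, gram_apply, Finset.sum_mul_sum]

theorem integrable_gram_mul_gram (hS : IsStdGaussianMatrix μ S) (i j k l : Fin n) :
    Integrable (fun ω => (S ω * (S ω)ᵀ) i j * (S ω * (S ω)ᵀ) k l) μ := by
  simp only [gram_mul_gram]
  exact integrable_finsetSum _ fun a _ => integrable_finsetSum _ fun b _ =>
    integrable_mul_four (memLp_four_entry hS) (i, a) (j, a) (k, b) (l, b)

/-- Summing the three pairings over columns `a, b`: the pairing inside each Gram entry leaves both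
free, hence `q ^ 2`; the other two force `a = b`, hence `q`. -/
theorem integral_gram_mul_gram (hS : IsStdGaussianMatrix μ S) (i j k l : Fin n) :
    ∫ ω, (S ω * (S ω)ᵀ) i j * (S ω * (S ω)ᵀ) k l ∂μ
      = q ^ 2 * ((if i = j then 1 else 0) * (if k = l then 1 else 0))
        + q * ((if i = k then 1 else 0) * (if j = l then 1 else 0))
        + q * ((if i = l then 1 else 0) * (if j = k then 1 else 0)) := by
  simp only [gram_mul_gram]
  have hI : ∀ a b, Integrable (fun ω => S ω i a * S ω j a * (S ω k b * S ω l b)) μ := fun a b =>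
    integrable_mul_four (memLp_four_entry hS) (i, a) (j, a) (k, b) (l, b)
  rw [integral_finsetSum _ fun a _ => integrable_finsetSum _ fun b _ => hI a b]
  have hE : ∀ a b, ∫ ω, S ω i a * S ω j a * (S ω k b * S ω l b) ∂μ
      = (if i = j then 1 else 0) * (if k = l then 1 else 0)
        + (if a = b then 1 else 0) * ((if i = k then 1 else 0) * (if j = l then 1 else 0))
        + (if a = b then 1 else 0) * ((if i = l then 1 else 0) * (if j = k then 1 else 0)) := by
    intro a b
    refine (integral_mul_four_gaussian hS (i, a) (j, a) (k, b) (l, b)).trans ?_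
    simp only [Prod.mk.injEq, ite_and]
    split_ifs <;> simp_all
  simp only [fun a => integral_finsetSum Finset.univ fun b _ => hI a b, hE,
    Finset.sum_add_distrib, ← Finset.sum_mul]
  simp
  ring_nf

theorem trace_mul_eq_sum (C D : Matrix (Fin n) (Fin n) ℝ) :
    (C * D).trace = ∑ i, ∑ j, C i j * D j i := rfl

theorem integral_trace_gram_mul [IsProbabilityMeasure μ] (hS : IsStdGaussianMatrix μ S) (H : Matrix (Fin n) (Fin n) ℝ) :
    Integrable (fun ω => (S ω * (S ω)ᵀ * H).trace) μ ∧
    ∫ ω, (S ω * (S ω)ᵀ * H).trace ∂μ = q * H.trace := by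
  simp only [trace_mul_eq_sum]
  have hI : ∀ i j, Integrable (fun ω => (S ω * (S ω)ᵀ) i j * H j i) μ := fun i j =>
    (integrable_gram hS i j).mul_const _
  refine ⟨integrable_finsetSum _ fun i _ => integrable_finsetSum _ fun j _ => hI i j, ?_⟩
  rw [integral_finsetSum _ fun i _ => integrable_finsetSum _ fun j _ => hI i j]
  simp only [fun i => integral_finsetSum Finset.univ fun j _ => hI i j, integral_mul_const,
    integral_gram hS]
  simp [Matrix.trace, Finset.mul_sum]

theorem trace_mul_mul_mul_eq_sum (W K H : Matrix (Fin n) (Fin n) ℝ) :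
    (W * K * (W * H)).trace = ∑ i, ∑ k, ∑ j, ∑ l, W i j * W k l * (K j k * H l i) := by
  rw [trace_mul_eq_sum]
  refine Finset.sum_congr rfl fun i _ => Finset.sum_congr rfl fun k _ => ?_
  rw [Matrix.mul_apply, Matrix.mul_apply, Finset.sum_mul_sum]
  exact Finset.sum_congr rfl fun j _ => Finset.sum_congr rfl fun l _ => by ring

theorem integral_sum_four {f : Fin n → Fin n → Fin n → Fin n → Ω → ℝ}
    (hf : ∀ i k j l, Integrable (f i k j l) μ) :
    ∫ ω, ∑ i, ∑ k, ∑ j, ∑ l, f i k j l ω ∂μ = ∑ i, ∑ k, ∑ j, ∑ l, ∫ ω, f i k j l ω ∂μ := by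
  rw [integral_finsetSum _ fun i _ => integrable_finsetSum _ fun k _ =>
    integrable_finsetSum _ fun j _ => integrable_finsetSum _ fun l _ => hf i k j l]
  refine Finset.sum_congr rfl fun i _ => ?_
  rw [integral_finsetSum _ fun k _ => integrable_finsetSum _ fun j _ =>
    integrable_finsetSum _ fun l _ => hf i k j l]
  refine Finset.sum_congr rfl fun k _ => ?_
  rw [integral_finsetSum _ fun j _ => integrable_finsetSum _ fun l _ => hf i k j l]
  exact Finset.sum_congr rfl fun j _ => integral_finsetSum _ fun l _ => hf i k j l

/-- Each pairing collapses the fourfold sum to a trace expression. One of them gives the trace of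
`Kᵀ * H`, which symmetry of `K` merges with that of `K * H`. -/
theorem integral_trace_gram_mul_gram_mul (hS : IsStdGaussianMatrix μ S)
    {K H : Matrix (Fin n) (Fin n) ℝ} (hK : Kᵀ = K) :
    Integrable (fun ω => (S ω * (S ω)ᵀ * K * (S ω * (S ω)ᵀ * H)).trace) μ ∧
    ∫ ω, (S ω * (S ω)ᵀ * K * (S ω * (S ω)ᵀ * H)).trace ∂μ
      = (q ^ 2 + q) * (K * H).trace + q * (K.trace * H.trace) := by
  simp only [trace_mul_mul_mul_eq_sum]
  have hI : ∀ i k j l, Integrable (fun ω =>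
      (S ω * (S ω)ᵀ) i j * (S ω * (S ω)ᵀ) k l * (K j k * H l i)) μ := fun i k j l =>
    (integrable_gram_mul_gram hS i j k l).mul_const _
  refine ⟨integrable_finsetSum _ fun i _ => integrable_finsetSum _ fun k _ =>
    integrable_finsetSum _ fun j _ => integrable_finsetSum _ fun l _ => hI i k j l, ?_⟩
  rw [integral_sum_four hI]
  simp only [integral_mul_const, integral_gram_mul_gram hS]
  have e1 : ∑ i, ∑ k, ∑ j, ∑ l, (q : ℝ) ^ 2 * ((if i = j then 1 else 0) *
      (if k = l then 1 else 0)) * (K j k * H l i) = q ^ 2 * (K * H).trace := by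
    simp [trace_mul_eq_sum, Finset.mul_sum]
  have e2 : ∑ i, ∑ k, ∑ j, ∑ l, (q : ℝ) * ((if i = k then 1 else 0) *
      (if j = l then 1 else 0)) * (K j k * H l i) = q * (K * H).trace := by
    have hK' : ∀ i j, K j i = K i j := fun i j => congrFun (congrFun hK i) j
    simp [trace_mul_eq_sum, Finset.mul_sum, hK']
  have e3 : ∑ i, ∑ k, ∑ j, ∑ l, (q : ℝ) * ((if i = l then 1 else 0) *
      (if j = k then 1 else 0)) * (K j k * H l i) = q * (K.trace * H.trace) := by
    simp only [Matrix.trace, Matrix.diag, Finset.sum_mul_sum]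
    rw [Finset.sum_comm]
    simp [Finset.mul_sum]
  simp only [add_mul, Finset.sum_add_distrib, e1, e2, e3]

theorem frobSq_sub_mul_gram (F G : Matrix (Fin n) (Fin n) ℝ) (hF : Fᵀ = F) (hG : Gᵀ = G)
    (M : Matrix (Fin n) (Fin q) ℝ) (c : ℝ) :
    frobSq (F - F * M * (c • (Mᵀ * G))) = (F * F).trace
      - 2 * c * (M * Mᵀ * (G * (F * F))).trace
      + c ^ 2 * (M * Mᵀ * (F * F) * (M * Mᵀ * (G * G))).trace := by
  have hT : (F * M * (c • (Mᵀ * G)))ᵀ = c • (G * (M * Mᵀ) * F) := by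
    simp [Matrix.transpose_mul, hF, hG, Matrix.mul_assoc]
  rw [frobSq, Matrix.transpose_sub, hT, hF]
  have hX : F * M * (c • (Mᵀ * G)) = c • (F * (M * Mᵀ) * G) := by
    simp [Matrix.mul_assoc]
  rw [hX]
  have hW : (M * Mᵀ)ᵀ = M * Mᵀ := by simp
  generalize M * Mᵀ = W at hW ⊢
  simp only [Matrix.sub_mul, Matrix.mul_sub, Matrix.trace_sub, Matrix.smul_mul, Matrix.mul_smul,
    Matrix.trace_smul, smul_eq_mul]
  have h1 : (F * (F * W * G)).trace = (W * (G * (F * F))).trace := by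
    rw [← Matrix.mul_assoc, ← Matrix.mul_assoc, Matrix.mul_assoc (F * F), Matrix.trace_mul_comm,
      Matrix.mul_assoc]
  have h2 : (G * W * F * F).trace = (W * (G * (F * F))).trace := by
    rw [← Matrix.trace_transpose]
    simp only [Matrix.transpose_mul, hF, hG, hW]
    rw [← Matrix.mul_assoc F F, ← Matrix.mul_assoc, Matrix.trace_mul_comm,
      ← Matrix.mul_assoc, Matrix.trace_mul_comm]
  have h3 : (G * W * F * (F * W * G)).trace = (W * (F * F) * (W * (G * G))).trace := by
    rw [show G * W * F * (F * W * G) = G * (W * (F * F) * (W * G)) by simp only [Matrix.mul_assoc],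
      Matrix.trace_mul_comm]
    simp only [Matrix.mul_assoc]
  rw [h1, h2, h3]
  ring

/-- Mean squared error of the Gaussian sketch `c F S Sᵀ G` as an approximation of `F`. -/
theorem integral_frobSq_sub_mul_gram [IsProbabilityMeasure μ] (hS : IsStdGaussianMatrix μ S)
    {F G : Matrix (Fin n) (Fin n) ℝ} (hF : Fᵀ = F) (hG : Gᵀ = G) (c : ℝ) :
    Integrable (fun ω => frobSq (F - F * S ω * (c • ((S ω)ᵀ * G)))) μ ∧
    ∫ ω, frobSq (F - F * S ω * (c • ((S ω)ᵀ * G))) ∂μ = (F * F).trace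
      - 2 * c * (q * (G * (F * F)).trace)
      + c ^ 2 * ((q ^ 2 + q) * (F * F * (G * G)).trace
        + q * ((F * F).trace * (G * G).trace)) := by
  obtain ⟨i1, e1⟩ := integral_trace_gram_mul hS (G * (F * F))
  obtain ⟨i2, e2⟩ := integral_trace_gram_mul_gram_mul hS (K := F * F) (H := G * G)
    (by rw [Matrix.transpose_mul, hF])
  simp only [fun ω => frobSq_sub_mul_gram F G hF hG (S ω) c]
  have i0 : Integrable (fun _ : Ω => (F * F).trace) μ := integrable_const _
  refine ⟨(i0.sub (i1.const_mul _)).add (i2.const_mul _), ?_⟩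
  refine (integral_add (i0.sub (i1.const_mul _)) (i2.const_mul _)).trans ?_
  refine (congrArg (· + _) (integral_sub i0 (i1.const_mul _))).trans ?_
  rw [integral_const_mul, integral_const_mul, e1, e2]
  simp

end Gaussian

/-! ### The spectral filter and the diagonalization of the logarithm -/

section Spectral

/-- The left side is the mean squared sketching error in eigenvalue coordinates. Apart from the term
`(1/q) ∑ d² g²`, it decouples into ridge problems `d² (1 - g)² + a² g²` with `a² = (∑ d²) / q`.
Their minimizers `g = d² / (d² + a²)` have values `d² a² / (d² + a²) ≤ d a / 2`, which sum to a
multiple of the trace. -/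
theorem exists_filter_sum_le {ι : Type*} [Fintype ι] (d : ι → ℝ) (hd : ∀ i, 0 ≤ d i) {q : ℝ}
    (hq : 128 ≤ q) : ∃ g : ι → ℝ,
      ∑ i, d i ^ 2 - 2 * ∑ i, g i * d i ^ 2 + (1 + 1 / q) * ∑ i, d i ^ 2 * g i ^ 2
        + (1 / q) * ((∑ i, d i ^ 2) * ∑ i, g i ^ 2) ≤ (∑ i, d i) ^ 2 / 16 := by
  have hq0 : 0 < q := by linarith
  set T := ∑ i, d i ^ 2 with hT
  set t := ∑ i, d i with ht
  have hT0 : 0 ≤ T := Finset.sum_nonneg fun i _ => sq_nonneg _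
  have ht0 : 0 ≤ t := Finset.sum_nonneg fun i _ => hd i
  have hTt : T ≤ t ^ 2 := Finset.sum_sq_le_sq_sum_of_nonneg fun i _ => hd i
  -- If all `d i` vanish then `a = 0` and the filter would be `0 / 0`; here `g = 0` serves.
  rcases hT0.eq_or_lt with hT' | hT'
  · refine ⟨0, ?_⟩
    rw [← hT']
    simp
    positivity
  set a := Real.sqrt (T / q) with ha
  have ha2 : a ^ 2 = T / q := Real.sq_sqrt (by positivity)
  have ha0 : 0 < a := Real.sqrt_pos.2 (by positivity)
  -- `a² ≤ t² / 128` and `11² = 121 ≤ 128`.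
  have hat : a ≤ t / 11 := by
    rw [ha]
    refine Real.sqrt_le_iff.2 ⟨by positivity, ?_⟩
    rw [div_le_iff₀ hq0]
    nlinarith [sq_nonneg t]
  have hTq : T / q ≤ t ^ 2 / 128 := by
    rw [div_le_div_iff₀ hq0 (by norm_num)]
    nlinarith [sq_nonneg t]
  refine ⟨fun i => d i ^ 2 / (d i ^ 2 + a ^ 2), ?_⟩
  have hterm : ∀ i, d i ^ 2 - 2 * (d i ^ 2 / (d i ^ 2 + a ^ 2) * d i ^ 2)
      + (1 + 1 / q) * (d i ^ 2 * (d i ^ 2 / (d i ^ 2 + a ^ 2)) ^ 2)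
      + a ^ 2 * (d i ^ 2 / (d i ^ 2 + a ^ 2)) ^ 2 ≤ d i * (a / 2) + d i ^ 2 / q := by
    intro i
    have hpos : 0 < d i ^ 2 + a ^ 2 := by positivity
    set g := d i ^ 2 / (d i ^ 2 + a ^ 2) with hg
    have hg1 : g * (d i ^ 2 + a ^ 2) = d i ^ 2 := div_mul_cancel₀ _ hpos.ne'
    have hg0 : 0 ≤ g := by positivity
    have hgle : g ≤ 1 := div_le_one_of_le₀ (by nlinarith) hpos.le
    have h1 : d i ^ 2 * g ^ 2 / q ≤ d i ^ 2 / q := by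
      gcongr
      nlinarith [sq_nonneg (d i), mul_le_one₀ hgle hg0 hgle]
    have h2 : d i ^ 2 - g * d i ^ 2 ≤ d i * (a / 2) := by
      have : d i ^ 2 - g * d i ^ 2 = d i ^ 2 * a ^ 2 / (d i ^ 2 + a ^ 2) := by
        rw [hg]; field_simp; ring
      rw [this, div_le_iff₀ hpos]
      have := mul_nonneg (mul_nonneg (hd i) ha0.le) (sq_nonneg (d i - a))
      nlinarith
    have h3 : d i ^ 2 - 2 * (g * d i ^ 2) + (1 + 1 / q) * (d i ^ 2 * g ^ 2) + a ^ 2 * g ^ 2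
        = (d i ^ 2 - g * d i ^ 2) + d i ^ 2 * g ^ 2 / q := by
      have : g ^ 2 * (d i ^ 2 + a ^ 2) = g * d i ^ 2 := by rw [pow_two, mul_assoc, hg1]
      rw [add_mul, one_mul, one_div_mul_eq_div]
      linarith
    rw [h3]
    linarith
  have hsum := Finset.sum_le_sum fun i (_ : i ∈ Finset.univ) => hterm i
  simp only [Finset.sum_add_distrib, Finset.sum_sub_distrib, ← Finset.mul_sum, ← Finset.sum_mul,
    ← Finset.sum_div] at hsum
  rw [← hT, ← ht, ha2] at hsum
  -- The total is at most `(1/22 + 1/128) t²`, which is below `t² / 16`.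
  have h4 : t * (a / 2) ≤ t ^ 2 / 22 := by nlinarith
  have h5 : ∀ x : ℝ, (1 / q) * (T * x) = T / q * x := fun x => by ring
  rw [h5, ha2]
  nlinarith [sq_nonneg t]

theorem trace_unitary_conj {n : ℕ} {U : Matrix (Fin n) (Fin n) ℝ} (hU : Uᵀ * U = 1)
    (x : Fin n → ℝ) : (U * Matrix.diagonal x * Uᵀ).trace = ∑ i, x i := by
  rw [Matrix.trace_mul_comm, ← Matrix.mul_assoc, hU, Matrix.one_mul, Matrix.trace_diagonal]

theorem unitary_conj_mul {n : ℕ} {U : Matrix (Fin n) (Fin n) ℝ} (hU : Uᵀ * U = 1)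
    (x y : Fin n → ℝ) : U * Matrix.diagonal x * Uᵀ * (U * Matrix.diagonal y * Uᵀ)
      = U * Matrix.diagonal (fun i => x i * y i) * Uᵀ := by
  rw [← Matrix.diagonal_mul_diagonal]
  calc _ = U * Matrix.diagonal x * (Uᵀ * U) * Matrix.diagonal y * Uᵀ := by
        simp only [Matrix.mul_assoc]
    _ = _ := by rw [hU, Matrix.mul_one, Matrix.mul_assoc U]

theorem unitary_conj_transpose {n : ℕ} (U : Matrix (Fin n) (Fin n) ℝ) (x : Fin n → ℝ) :
    (U * Matrix.diagonal x * Uᵀ)ᵀ = U * Matrix.diagonal x * Uᵀ := by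
  simp [Matrix.transpose_mul, Matrix.mul_assoc]

theorem exists_matrixLog_eq {n : ℕ} {A : Matrix (Fin n) (Fin n) ℝ} (hA : A.IsHermitian)
    (hmin : ∀ i, 1 ≤ hA.eigenvalues i) :
    ∃ (U : Matrix (Fin n) (Fin n) ℝ) (d : Fin n → ℝ), Uᵀ * U = 1 ∧ (∀ i, 0 ≤ d i) ∧
      matrixLog A = U * Matrix.diagonal d * Uᵀ := by
  refine ⟨hA.eigenvectorUnitary, fun i => Real.log (hA.eigenvalues i), ?_,
    fun i => Real.log_nonneg (hmin i), ?_⟩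
  · have := Unitary.coe_star_mul_self hA.eigenvectorUnitary
    rwa [Matrix.star_eq_conjTranspose, Matrix.conjTranspose_eq_transpose_of_trivial] at this
  · rw [matrixLog, hA.cfc_eq, Matrix.IsHermitian.cfc, Unitary.conjStarAlgAut_apply,
      Matrix.star_eq_conjTranspose, Matrix.conjTranspose_eq_transpose_of_trivial]
    rfl

end Spectral

/-! ### The sketching bound and the measurable form of the deflated matrix -/

section Deflation

variable {Ω : Type*} [MeasurableSpace Ω] {μ : Measure Ω} [IsProbabilityMeasure μ]
  {n q : ℕ} {S : Ω → Matrix (Fin n) (Fin q) ℝ}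

/-- A Gaussian sketch with at least 128 columns captures a positive semidefinite matrix up to a
mean squared Frobenius error of `tr(F)² / 16`. -/
theorem exists_sketch_integral_frobSq_le (hS : IsStdGaussianMatrix μ S) (hq : 128 ≤ (q : ℝ))
    {U : Matrix (Fin n) (Fin n) ℝ} (hU : Uᵀ * U = 1) {d : Fin n → ℝ} (hd : ∀ i, 0 ≤ d i)
    {F : Matrix (Fin n) (Fin n) ℝ} (hF : F = U * Matrix.diagonal d * Uᵀ) :
    ∃ X : Ω → Matrix (Fin q) (Fin n) ℝ,
      Integrable (fun ω => frobSq (F - F * S ω * X ω)) μ ∧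
      ∫ ω, frobSq (F - F * S ω * X ω) ∂μ ≤ F.trace ^ 2 / 16 := by
  obtain ⟨g, hg⟩ := exists_filter_sum_le d hd hq
  have hq0 : (q : ℝ) ≠ 0 := by linarith
  -- The scale `1 / q` normalizes the Gram matrix `S Sᵀ`, whose mean is `q` times the identity.
  obtain ⟨hi, he⟩ := integral_frobSq_sub_mul_gram hS (F := F) (G := U * Matrix.diagonal g * Uᵀ)
    (by rw [hF, unitary_conj_transpose]) (unitary_conj_transpose U g) (1 / q)
  refine ⟨_, hi, ?_⟩
  rw [he, hF]
  simp only [unitary_conj_mul hU, trace_unitary_conj hU]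
  refine le_trans (le_of_eq ?_) hg
  simp only [← pow_two]
  field_simp
  ring

theorem deflated_eq_complProj {F : Matrix (Fin n) (Fin n) ℝ} {M : Matrix (Fin n) (Fin q) ℝ} {r : ℕ}
    {Q : Matrix (Fin n) (Fin r) ℝ} (hQ : IsOrthonormalBasisOfRange Q M) :
    deflated F Q = complProj M * F * complProj M := by
  rw [complProj_eq hQ, deflated]

theorem measurable_complProj_mul_mul (F : Matrix (Fin n) (Fin n) ℝ) :
    Measurable fun (s : Fin n × Fin q → ℝ) (e : Fin n × Fin n) =>
      (complProj (F * Matrix.of fun i j => s (i, j)) * F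
        * complProj (F * Matrix.of fun i j => s (i, j))) e.1 e.2 := by
  have h := measurable_complProj (E := Fin n × Fin q → ℝ)
    (M := fun s => F * Matrix.of fun i j => s (i, j)) (fun i j => by
      simp only [Matrix.mul_apply, Matrix.of_apply]
      fun_prop)
  refine measurable_pi_lambda _ fun e => ?_
  simp only [Matrix.mul_apply] at h ⊢
  fun_prop

theorem sq_le_frobSq (M : Matrix (Fin n) (Fin n) ℝ) (i j : Fin n) : M i j ^ 2 ≤ frobSq M := by
  rw [frobSq_eq_sum]
  refine le_trans ?_ (Finset.single_le_sum (f := fun i => ∑ j, M i j ^ 2)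
    (fun i _ => by positivity) (Finset.mem_univ i))
  exact Finset.single_le_sum (f := fun j => M i j ^ 2) (fun j _ => by positivity)
    (Finset.mem_univ j)

end Deflation

/-! ### Numerical constants and the final probability bound -/

theorem two_div_le_sampleSize {ε δ x : ℝ} (hε : 0 < ε) (hδ : 0 < δ)
    (hN : (1 + Real.sqrt (1 + 4 * ε * Real.sqrt δ)) ^ 2 / (2 * ε ^ 2 * δ) ≤ x) :
    2 / (ε ^ 2 * δ) ≤ x := by
  refine le_trans ?_ hN
  -- The square root is at least 1, so the numerator is at least 4.
  have h1 : 1 ≤ Real.sqrt (1 + 4 * ε * Real.sqrt δ) :=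
    Real.one_le_sqrt.2 (by have := Real.sqrt_nonneg δ; nlinarith [mul_nonneg hε.le this])
  rw [div_le_div_iff₀ (by positivity) (by positivity)]
  have : 4 * (ε ^ 2 * δ) ≤ (1 + Real.sqrt (1 + 4 * ε * Real.sqrt δ)) ^ 2 * (ε ^ 2 * δ) := by
    gcongr
    nlinarith
  linarith

/-- Since `δ < 1`, the first condition gives `k > 64`. The denominator `k δ² - 64` is positive and
below `k`, so the quotient is at least 64 and `p ≥ 65`. -/
theorem le_sketchSize {δ : ℝ} (hδ : δ ∈ Set.Ioo (0 : ℝ) 1) {k p : ℕ} (hk : 64 / δ ^ 2 < (k : ℝ))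
    (hp : 1 + 64 * (k : ℝ) / ((k : ℝ) * δ ^ 2 - 64) ≤ (p : ℝ)) : 128 ≤ ((k + p : ℕ) : ℝ) := by
  have hδ2 : 0 < δ ^ 2 := pow_pos hδ.1 2
  have hδ1 : δ ^ 2 ≤ 1 := by nlinarith [hδ.1, hδ.2]
  rw [div_lt_iff₀ hδ2] at hk
  have hk64 : 64 < (k : ℝ) := by nlinarith [(k.cast_nonneg : (0 : ℝ) ≤ k)]
  have h : 64 ≤ 64 * (k : ℝ) / ((k : ℝ) * δ ^ 2 - 64) := by
    rw [le_div_iff₀ (by linarith)]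
    nlinarith
  push_cast
  linarith

theorem mainTheorem10 {Ω : Type*} [MeasurableSpace Ω] (μ : Measure Ω) [IsProbabilityMeasure μ]
    (ε δ : ℝ) (hε : ε ∈ Set.Ioo (0 : ℝ) 1) (hδ : δ ∈ Set.Ioo (0 : ℝ) 1)
    (n k p N : ℕ) (A : Matrix (Fin n) (Fin n) ℝ) (hA : A.PosDef)
    (hmin : ∀ i, 1 ≤ hA.isHermitian.eigenvalues i)
    (hk : 64 / δ ^ 2 < (k : ℝ))
    (hp : 1 + 64 * (k : ℝ) / ((k : ℝ) * δ ^ 2 - 64) ≤ (p : ℝ))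
    (hN : (1 + Real.sqrt (1 + 4 * ε * Real.sqrt δ)) ^ 2 / (2 * ε ^ 2 * δ) ≤ (N : ℝ))
    (S : Ω → Matrix (Fin n) (Fin (k + p)) ℝ) (hS : IsStdGaussianMatrix μ S)
    (z : Fin N → Ω → Fin n → ℝ) (hz : IsRademacherFamily μ z)
    (hSz : IndepFun (fun ω (e : Fin n × Fin (k + p)) => S ω e.1 e.2)
      (fun ω (e : Fin N × Fin n) => z e.1 ω e.2) μ)
    (r : Ω → ℕ) (Q : (ω : Ω) → Matrix (Fin n) (Fin (r ω)) ℝ)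
    (hQ : ∀ᵐ ω ∂μ, IsOrthonormalBasisOfRange (Q ω) (matrixLog A * S ω)) :
    1 - δ ≤ μ.real {ω |
      |hutchinson (deflated (matrixLog A) (Q ω)) (fun l => z l ω)
          - (deflated (matrixLog A) (Q ω)).trace|
        ≤ ε / 4 * (matrixLog A).trace} := by
  obtain ⟨U, d, hU, hd, hF⟩ := exists_matrixLog_eq hA.isHermitian hmin
  generalize matrixLog A = F at hF hQ ⊢
  have htr : F.trace = ∑ i, d i := by rw [hF, trace_unitary_conj hU]
  have ht0 : 0 ≤ F.trace := htr ▸ Finset.sum_nonneg fun i _ => hd i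
  -- Chebyshev needs a positive threshold. Zero trace forces `F = 0`, and then the error vanishes
  -- identically.
  rcases ht0.eq_or_lt with ht | ht
  · have hd0 : d = 0 := by
      rw [htr, eq_comm, Finset.sum_eq_zero_iff_of_nonneg fun i _ => hd i] at ht
      exact funext fun i => ht i (Finset.mem_univ i)
    have hF0 : F = 0 := by rw [hF, hd0]; simp
    have : ∀ ω, deflated F (Q ω) = 0 := fun ω => by simp [deflated, hF0]
    simp [this, hutchinson, ← ht, hδ.1.le]
  have hN2 := two_div_le_sampleSize hε.1 hδ.1 hN
  have hεδ : 0 < ε ^ 2 * δ := mul_pos (pow_pos hε.1 2) hδ.1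
  have hNpos : (0 : ℝ) < N := lt_of_lt_of_le (div_pos two_pos hεδ) hN2
  have hN0 : N ≠ 0 := by rintro rfl; simp at hNpos
  obtain ⟨X, hXi, hX⟩ := exists_sketch_integral_frobSq_le hS (le_sketchSize hδ hk hp) hU hd hF
  -- `B` agrees almost surely with the deflated matrix but is a measurable function of `S` alone.
  set B : Ω → Matrix (Fin n) (Fin n) ℝ :=
    fun ω => complProj (F * S ω) * F * complProj (F * S ω) with hB
  have hBQ : ∀ᵐ ω ∂μ, deflated F (Q ω) = B ω := by
    filter_upwards [hQ] with ω hω using deflated_eq_complProj hω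
  have hSm : AEMeasurable (fun ω (e : Fin n × Fin (k + p)) => S ω e.1 e.2) μ :=
    aemeasurable_pi_lambda _ fun e => (hS.hasLaw_entry e.1 e.2).aemeasurable
  have hmeas := measurable_complProj_mul_mul (q := k + p) F
  have hind : IndepFun (fun ω (e : Fin n × Fin n) => B ω e.1 e.2)
      (fun ω (e : Fin N × Fin n) => z e.1 ω e.2) μ := hSz.comp hmeas measurable_id
  have hBm : ∀ i j, AEMeasurable (fun ω => B ω i j) μ := fun i j =>
    (aemeasurable_pi_iff.1 (hmeas.comp_aemeasurable hSm)) (i, j)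
  -- The choice `X = 0` bounds `B` uniformly, so its entries are square integrable.
  have hBle : ∀ᵐ ω ∂μ, frobSq (B ω) ≤ frobSq F := by
    filter_upwards [hQ, hBQ] with ω h1 h2
    simpa [h2] using frobSq_deflated_le (F := F) h1 0
  have hBL : ∀ i j, MemLp (fun ω => B ω i j) 2 μ := fun i j => by
    refine MemLp.of_bound (hBm i j).aestronglyMeasurable (Real.sqrt (frobSq F)) ?_
    filter_upwards [hBle] with ω h
    exact Real.abs_le_sqrt ((sq_le_frobSq _ i j).trans h)
  obtain ⟨hDi, hD⟩ := integral_hutchinson_sub_trace_sq_le hz hind hBL hN0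
  have hBint : Integrable (fun ω => frobSq (B ω)) μ := by
    simp only [frobSq_eq_sum]
    exact integrable_finsetSum _ fun i _ => integrable_finsetSum _ fun j _ =>
      (hBL i j).integrable_sq
  have hBX : ∫ ω, frobSq (B ω) ∂μ ≤ F.trace ^ 2 / 16 := by
    refine le_trans (integral_mono_ae hBint hXi ?_) hX
    filter_upwards [hQ, hBQ] with ω h1 h2
    simpa [h2] using frobSq_deflated_le (F := F) h1 (X ω)
  set τ := ε / 4 * F.trace with hτ
  have hτ0 : 0 < τ := mul_pos (by linarith [hε.1]) ht
  have hcheb := mul_meas_ge_le_integral_of_nonneg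
    (Filter.Eventually.of_forall fun ω => sq_nonneg _) hDi (τ ^ 2)
  have hDτ : ∫ ω, (hutchinson (B ω) (fun l => z l ω) - (B ω).trace) ^ 2 ∂μ ≤ τ ^ 2 * δ := by
    calc _ ≤ 2 / N * (F.trace ^ 2 / 16) := hD.trans (by gcongr)
      _ ≤ (ε ^ 2 * δ) * (F.trace ^ 2 / 16) := by
        gcongr
        rw [div_le_iff₀ hNpos]
        rw [div_le_iff₀ hεδ] at hN2
        linarith
      _ = τ ^ 2 * δ := by rw [hτ]; ring
  have hbad := le_of_mul_le_mul_left (hcheb.trans hDτ) (pow_pos hτ0 2)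
  -- The event in question need not be measurable, so its complement is not used. The whole space is
  -- covered by a null set, the Chebyshev event and the event itself; subadditivity then suffices.
  have hcover : (1 : ℝ) ≤ μ.real ({ω | ¬ deflated F (Q ω) = B ω} ∪
      ({ω | τ ^ 2 ≤ (hutchinson (B ω) (fun l => z l ω) - (B ω).trace) ^ 2} ∪
      {ω | |hutchinson (deflated F (Q ω)) (fun l => z l ω) - (deflated F (Q ω)).trace| ≤ τ})) := by
    rw [← probReal_univ (μ := μ)]
    refine measureReal_mono fun ω _ => ?_
    by_cases h : deflated F (Q ω) = B ω
    · right
      by_cases h' : τ ^ 2 ≤ (hutchinson (B ω) (fun l => z l ω) - (B ω).trace) ^ 2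
      · exact Or.inl h'
      · refine Or.inr ?_
        change |_| ≤ τ
        rw [h]
        exact (abs_lt_of_sq_lt_sq (not_le.1 h') hτ0.le).le
    · exact Or.inl h
  have hnull : μ.real {ω | ¬ deflated F (Q ω) = B ω} = 0 := by
    rw [measureReal_def, ae_iff.1 hBQ, ENNReal.toReal_zero]
  have h1 := hcover.trans (measureReal_union_le _ _)
  rw [hnull, zero_add] at h1
  linarith [h1.trans (measureReal_union_le _ _)]
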